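/- Let $\alpha$ be an algebraic number of degree $d\ge 3$ over $\mathbf{Q}$, let $K=\mathbf{Q}(\alpha)$, let $\mathbf{Z}_K^\times$ be the group of units of the ring of integers of $K$, and let $r$ be its rank. For $\gamma\in K$, let $\operatorname{house}(\gamma)$ be the maximum of $|\varphi(\gamma)|$ over all embeddings $\varphi$ of $K$ into $\mathbf{C}$. For a subset $\mathcal{F}$ of $\mathbf{Z}_K^\times$ and a real number $N$, let $\mathcal{F}(N)=\{\varepsilon\in\mathcal{F} : \operatorname{house}(\alpha\varepsilon)\le N\}$, and let $|\mathcal{F}(N)|$ be its number of elements. Let $$\mathcal{E}^{(\alpha)}=\{\varepsilon\in\mathbf{Z}_K^\times : \mathbf{Q}(\alpha\varepsilon)=K\}.$$ For $0<\nu<1$, let $\mathcal{E}_\nu^{(\alpha)}$ be the set of $\varepsilon\in\mathcal{E}^{(\alpha)}$ for which there are two distinct embeddings $\varphi_1,\varphi_2$ of $K$ into $\mathbf{C}$ with $$|\varphi_1(\alpha\varepsilon)|=\operatorname{house}(\alpha\varepsilon)\quad\text{and}\quad|\varphi_2(\alpha\varepsilon)|\ge\operatorname{house}(\alpha\varepsilon)^{\nu},$$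 and let $\tilde{\mathcal{E}}_\nu^{(\alpha)}$ be the set of $\varepsilon\in\mathcal{E}_\nu^{(\alpha)}$ such that $\varepsilon^{-1}\in\mathcal{E}_\nu^{(1/\alpha)}$. Then the following hold, where $N$ tends to infinity through the real numbers. (a) The set $\mathbf{Z}_K^\times(N)$ is finite for every $N$, and the limit $$\lim_{N\to\infty}\frac{|\mathbf{Z}_K^\times(N)|}{(\log N)^r}$$ exists and is positive (and finite). (b) $\displaystyle\liminf_{N\to\infty}\frac{|\mathcal{E}^{(\alpha)}(N)|}{|\mathbf{Z}_K^\times(N)|}>0.$ (c) For every $\nu$ with $0<\nu<1/2$, $\displaystyle\liminf_{N\to\infty}\frac{|\mathcal{E}_\nu^{(\alpha)}(N)|}{(\log N)^r}>0.$ (d) If $d\ge 4$, then for every $\nu$ with $0<\nu<1$, $\displaystyle\liminf_{N\to\infty}\frac{|\tilde{\mathcal{E}}_\nu^{(\alpha)}(N)|}{(\log N)^r}>0.$ -/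

import Mathlib

open NumberField Filter Topology IntermediateField

/-- For `α` in a number field `K`, a set `F` of units of `K` and a real number `N`: the set `F(N)` of
the units `ε ∈ F` such that the house of `α ε` (the largest modulus of its images under the
embeddings of `K` into `ℂ`) is at most `N`. -/
def houseBounded {K : Type*} [Field K] [NumberField K] (α : K) (F : Set (𝓞 K)ˣ) (N : ℝ) :
    Set (𝓞 K)ˣ :=
  {ε | ε ∈ F ∧ house (α * (ε : K)) ≤ N}

/-- The set `𝓔^(α)` of the units `ε` of `K` such that `ℚ(α ε) = K`. -/
def generatingUnits {K : Type*} [Field K] [NumberField K] (α : K) : Set (𝓞 K)ˣ :=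
  {ε | ℚ⟮α * (ε : K)⟯ = ⊤}

/-- The set `𝓔_ν^(α)` of the units `ε ∈ 𝓔^(α)` for which there are two distinct embeddings
`φ₁`, `φ₂` of `K` into `ℂ` such that `|φ₁(α ε)|` is the house of `α ε` and
`|φ₂(α ε)|` is at least the `ν`-th power of the house of `α ε`. -/
def twoLargeUnits {K : Type*} [Field K] [NumberField K] (α : K) (ν : ℝ) : Set (𝓞 K)ˣ :=
  {ε | ε ∈ generatingUnits α ∧ ∃ φ₁ φ₂ : K →+* ℂ, φ₁ ≠ φ₂ ∧
    ‖φ₁ (α * (ε : K))‖ = house (α * (ε : K)) ∧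
    house (α * (ε : K)) ^ ν ≤ ‖φ₂ (α * (ε : K))‖}

/-- The set of the units `ε ∈ 𝓔_ν^(α)` such that `ε⁻¹ ∈ 𝓔_ν^(1/α)`. -/
def twoLargeTwoSmallUnits {K : Type*} [Field K] [NumberField K] (α : K) (ν : ℝ) : Set (𝓞 K)ˣ :=
  {ε | ε ∈ twoLargeUnits α ν ∧ ε⁻¹ ∈ twoLargeUnits α⁻¹ ν}

/-! The logarithmic embedding turns units, up to finite torsion, into a lattice of rank `r` in the
trace zero hyperplane. A bound on the house becomes a bound from above on all logarithms, hence
membership in a dilate of a compact convex body, and lattice point counting gives growth `c * T ^ r`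
with `T = log N`. Replacing `house ε` by `house (α * ε)` only shifts `T` by a bounded amount.

For the lower bounds, take a conjugation-invariant direction `v` of sum zero whose maximum `1` is
attained at two embeddings (and, in degree at least 4, whose minimum `-1` is too). Units with
logarithms close to `n * v` have two conjugates of nearly maximal size, and still number at least a
constant times `n ^ r`.

It remains to discard the units with `α * ε` in a proper subfield `F`. If the units in `F` have
infinite index, such `ε` have density zero, since many disjoint translates of them fit in a slightly
larger ball. If the index is finite, restrict to `m`-th powers for a suitable `m`: then `ε ∈ F`, so
`α ∈ F`, which is impossible. This is carried by `eventually_ncard_houseBounded_le_of_index_eq_zero`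
and `exists_mul_pow_le_ncard_nearUnits_inter_generatingUnits`. -/

open NumberField.Units NumberField.InfinitePlace NumberField.Units.dirichletUnitTheorem Module

/-! ### Linear forms and the convex body on the logarithmic space. -/

section LogSpace

variable {K : Type*} [Field K] [NumberField K]

open scoped Classical in
/-- The linear form on the logarithmic space whose value at the image of a unit `u` is
`log (w u)`. -/
noncomputable def placeForm (w : InfinitePlace K) : logSpace K →ₗ[ℝ] ℝ :=
  if h : w = w₀ then -(mult w : ℝ)⁻¹ • ∑ v, LinearMap.proj v
  else (mult w : ℝ)⁻¹ • LinearMap.proj ⟨w, h⟩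

theorem mult_mul_placeForm_of_ne (x : logSpace K) (w : {w : InfinitePlace K // w ≠ w₀}) :
    (mult w.1 : ℝ) * placeForm w.1 x = x w := by
  have : (mult w.1 : ℝ) ≠ 0 := by exact_mod_cast mult_ne_zero
  simp [placeForm, w.2, this]

open scoped Classical in
theorem mult_mul_placeForm_w₀ (x : logSpace K) :
    (mult (w₀ : InfinitePlace K) : ℝ) * placeForm w₀ x = -∑ v, x v := by
  have : (mult (w₀ : InfinitePlace K) : ℝ) ≠ 0 := by exact_mod_cast mult_ne_zero
  simp only [placeForm, dite_true, LinearMap.smul_apply, LinearMap.sum_apply, LinearMap.proj_apply,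
    smul_eq_mul]
  field_simp

theorem placeForm_logEmbedding (u : (𝓞 K)ˣ) (w : InfinitePlace K) :
    placeForm w (logEmbedding K (Additive.ofMul u)) = Real.log (w (u : K)) := by
  classical
  have hm : (mult w : ℝ) ≠ 0 := by exact_mod_cast mult_ne_zero
  apply mul_left_cancel₀ hm
  by_cases h : w = w₀
  · subst h
    rw [mult_mul_placeForm_w₀]
    have := sum_logEmbedding_component u
    rw [neg_eq_iff_eq_neg, ← neg_mul]
    convert this
  · rw [mult_mul_placeForm_of_ne _ ⟨w, h⟩, logEmbedding_component]

theorem sum_mult_mul_placeForm (x : logSpace K) :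
    ∑ w : InfinitePlace K, (mult w : ℝ) * placeForm w x = 0 := by
  classical
  rw [Fintype.sum_eq_add_sum_subtype_ne _ w₀, mult_mul_placeForm_w₀]
  simp_rw [mult_mul_placeForm_of_ne]
  rw [neg_add_eq_zero]

/-- A family of reals with weighted sum zero which is bounded above is bounded below. -/
theorem neg_le_of_sum_mult_mul_eq_zero {f : InfinitePlace K → ℝ}
    (h0 : ∑ w : InfinitePlace K, (mult w : ℝ) * f w = 0) {T : ℝ} (hT : 0 ≤ T)
    (h : ∀ w, f w ≤ T) (w : InfinitePlace K) : |f w| ≤ finrank ℚ K * T := by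
  classical
  have hm (w : InfinitePlace K) : (1 : ℝ) ≤ mult w := by exact_mod_cast one_le_mult
  have hd : (∑ w : InfinitePlace K, (mult w : ℝ)) = finrank ℚ K := by
    exact_mod_cast sum_mult_eq (K := K)
  have h1 : ∑ w : InfinitePlace K, (mult w : ℝ) * (T - f w) = finrank ℚ K * T := by
    simp_rw [mul_sub, Finset.sum_sub_distrib, h0, ← Finset.sum_mul, hd, sub_zero]
  have h2 : (mult w : ℝ) * (T - f w) ≤ finrank ℚ K * T := by
    rw [← h1]
    exact Finset.single_le_sum (f := fun w => (mult w : ℝ) * (T - f w))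
      (fun v _ => mul_nonneg (zero_le_one.trans (hm v)) (sub_nonneg.2 (h v))) (Finset.mem_univ w)
  have h3 : T - f w ≤ (mult w : ℝ) * (T - f w) :=
    le_mul_of_one_le_left (sub_nonneg.2 (h w)) (hm w)
  have h4 : (1 : ℝ) ≤ finrank ℚ K := by exact_mod_cast (finrank_pos (R := ℚ) (M := K))
  rw [abs_le]
  constructor
  · linarith
  · exact (h w).trans (le_mul_of_one_le_left hT h4)

/-- The set of the points of the logarithmic space at which all the `placeForm`s are at most
`T`. -/
def logRegion (K : Type*) [Field K] [NumberField K] (T : ℝ) : Set (logSpace K) :=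
  {x | ∀ w, placeForm w x ≤ T}

theorem isClosed_logRegion (T : ℝ) : IsClosed (logRegion K T) := by
  simp only [logRegion, Set.ofPred_forall]
  exact isClosed_iInter fun w =>
    isClosed_le (placeForm w).continuous_of_finiteDimensional continuous_const

theorem convex_logRegion (T : ℝ) : Convex ℝ (logRegion K T) := by
  simp only [logRegion, Set.ofPred_forall]
  exact convex_iInter fun w => convex_halfSpace_le (placeForm w).isLinear T

open scoped Classical in
theorem isBounded_logRegion {T : ℝ} (hT : 0 ≤ T) : Bornology.IsBounded (logRegion K T) := by
  refine isBounded_iff_forall_norm_le.2 ⟨2 * (finrank ℚ K * T), fun x hx => ?_⟩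
  refine (pi_norm_le_iff_of_nonneg (by positivity)).2 fun w => ?_
  rw [← mult_mul_placeForm_of_ne x w, Real.norm_eq_abs, abs_mul, Nat.abs_cast]
  -- The region is cut out by upper bounds only; the weighted sum zero relation supplies the lower
  -- ones.
  have h1 := neg_le_of_sum_mult_mul_eq_zero (sum_mult_mul_placeForm x) hT hx w
  have h2 : (mult w.1 : ℝ) ≤ 2 := by
    rw [mult]; split_ifs <;> norm_num
  gcongr

open scoped Classical MeasureTheory in
theorem volume_real_logRegion_pos : 0 < MeasureTheory.volume.real (logRegion K 1) := by
  have ho : IsOpen {x : logSpace K | ∀ w, placeForm w x < 1} := by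
    simp only [Set.ofPred_forall]
    exact isOpen_iInter_of_finite fun w =>
      isOpen_lt (placeForm w).continuous_of_finiteDimensional continuous_const
  have hne : {x : logSpace K | ∀ w, placeForm w x < 1}.Nonempty := ⟨0, by simp⟩
  refine ENNReal.toReal_pos ?_ (isBounded_logRegion zero_le_one).measure_lt_top.ne
  exact ((ho.measure_pos _ hne).trans_le
    (MeasureTheory.measure_mono fun x hx w => (hx w).le)).ne'

end LogSpace

/-! ### Lattice points in dilates of the convex body. -/

section CountLog

variable {K : Type*} [Field K] [NumberField K]

theorem card_ne_w₀ [Fintype {w : InfinitePlace K // w ≠ w₀}] :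
    Fintype.card {w : InfinitePlace K // w ≠ w₀} = rank K := by
  classical
  have := Units.finrank_eq_rank K
  rw [← this, finrank_fintype_fun_eq_card]

open scoped Classical in
/-- The number of points of the unit lattice in the dilates of `logRegion K 1`. -/
theorem exists_tendsto_card_logRegion_inter_unitLattice (hr : 0 < rank K) :
    ∃ c : ℝ, 0 < c ∧ Tendsto (fun T : ℝ =>
      (Nat.card (logRegion K T ∩ unitLattice K : Set (logSpace K)) : ℝ) / T ^ rank K)
      atTop (𝓝 c) := by
  have hcard := card_ne_w₀ (K := K)
  have : Nonempty {w : InfinitePlace K // w ≠ w₀} :=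
    Fintype.card_pos_iff.1 (hcard ▸ hr)
  -- The gauge of the region. Its `rank K`-th power is homogeneous of degree the dimension, as the
  -- lattice point count requires.
  let g : logSpace K → ℝ := fun x => Finset.univ.sup' Finset.univ_nonempty fun w => placeForm w x
  have hg (x : logSpace K) (T : ℝ) : g x ≤ T ↔ x ∈ logRegion K T := by
    simp [g, logRegion]
  have hg0 (x : logSpace K) : 0 ≤ g x := by
    by_contra! h
    have h1 : ∀ w, placeForm w x < 0 := fun w =>
      ((hg x (g x)).1 le_rfl w).trans_lt h
    have h2 := sum_mult_mul_placeForm x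
    refine (Finset.sum_neg (s := Finset.univ)
      (f := fun w : InfinitePlace K => (mult w : ℝ) * placeForm w x) (fun w _ => ?_)
      Finset.univ_nonempty).ne h2
    exact mul_neg_of_pos_of_neg (by exact_mod_cast mult_pos) (h1 w)
  have hgs (x : logSpace K) (r : ℝ) (h : 0 ≤ r) : g (r • x) = r * g x := by
    simp only [g, map_smul, smul_eq_mul]
    exact (Finset.apply_sup'_eq_sup'_comp Finset.univ_nonempty (r * ·)
      (fun a b => mul_max_of_nonneg a b h)).symm
  have hset (T : ℝ) (hT : 0 ≤ T) :
      {x ∈ (Set.univ : Set (logSpace K)) | g x ^ rank K ≤ T ^ rank K} = logRegion K T := by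
    ext x
    simp only [Set.mem_univ, true_and, Set.mem_ofPred_eq, ← hg]
    exact pow_le_pow_iff_left₀ (hg0 x) hT hr.ne'
  have hset1 : {x ∈ (Set.univ : Set (logSpace K)) | g x ^ rank K ≤ 1} = logRegion K 1 := by
    simpa using hset 1 zero_le_one
  have key := ZLattice.covolume.tendsto_card_le_div (unitLattice K) (X := Set.univ)
    (F := fun x => g x ^ rank K) (by simp)
    (fun x r h => by rw [hgs x r h, mul_pow, hcard])
    (by rw [hset1]; exact isBounded_logRegion zero_le_one)
    (by rw [hset1]; exact (isClosed_logRegion 1).measurableSet)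
    -- A convex set has null frontier.
    (by
      have := (convex_logRegion (K := K) 1).addHaar_frontier MeasureTheory.volume
      rwa [← hset1] at this)
  rw [hset1] at key
  refine ⟨_, div_pos (volume_real_logRegion_pos (K := K)) (ZLattice.covolume_pos (unitLattice K) MeasureTheory.volume), ?_⟩
  refine (key.comp (tendsto_pow_atTop hr.ne')).congr' ?_
  filter_upwards [eventually_ge_atTop 0] with T hT
  simp only [Function.comp_apply]
  rw [hset T hT]

/-- The condition only depends on the class modulo torsion, and the logarithmic embedding is
injective on classes. -/
theorem card_units_log_le (T : ℝ) :
    Nat.card {u : (𝓞 K)ˣ | ∀ w : InfinitePlace K, Real.log (w (u : K)) ≤ T} =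
      Nat.card (torsion K) *
        Nat.card (logRegion K T ∩ unitLattice K : Set (logSpace K)) := by
  let t : Set ((𝓞 K)ˣ ⧸ torsion K) :=
    {q | logEmbeddingQuot K (Additive.ofMul q) ∈ logRegion K T}
  have h1 : {u : (𝓞 K)ˣ | ∀ w : InfinitePlace K, Real.log (w (u : K)) ≤ T} =
      QuotientGroup.mk ⁻¹' t := by
    ext u
    simp only [Set.mem_ofPred_eq, Set.mem_preimage, t, logEmbeddingQuot_apply, logRegion,
      placeForm_logEmbedding]
  rw [h1, QuotientGroup.card_preimage_mk]
  congr 1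
  have h2 : (logRegion K T ∩ unitLattice K : Set (logSpace K)) =
      (fun q => logEmbeddingQuot K (Additive.ofMul q)) '' t := by
    ext x
    constructor
    · rintro ⟨hx, u, -, rfl⟩
      exact ⟨QuotientGroup.mk (Additive.toMul u), hx, rfl⟩
    · rintro ⟨q, hq, rfl⟩
      refine ⟨hq, ?_⟩
      induction q using QuotientGroup.induction_on with
      | H u => exact ⟨Additive.ofMul u, trivial, rfl⟩
  rw [h2]
  exact (Nat.card_image_of_injective
    ((logEmbeddingQuot_injective K).comp Additive.ofMul.injective) t).symm

end CountLog

/-! ### Counting units by the house. -/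

section CountHouse

variable {K : Type*} [Field K] [NumberField K]

theorem house_le_iff (x : K) (N : ℝ) : house x ≤ N ↔ ∀ φ : K →+* ℂ, ‖φ x‖ ≤ N := by
  refine ⟨fun h φ => (norm_embedding_le_house x φ).trans h, fun h => ?_⟩
  have h0 : 0 ≤ N := (norm_nonneg _).trans (h (Classical.arbitrary _))
  exact (pi_norm_le_iff_of_nonneg h0).2 h

theorem exists_norm_embedding_eq_house (x : K) : ∃ φ : K →+* ℂ, ‖φ x‖ = house x := by
  obtain ⟨φ, -, h⟩ := Finset.exists_mem_eq_sup' (Finset.univ_nonempty (α := K →+* ℂ))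
    (fun φ => ‖φ x‖₊)
  refine ⟨φ, ?_⟩
  rw [house_eq_sup', h, coe_nnnorm]

theorem house_pos {x : K} (hx : x ≠ 0) : 0 < house x :=
  (norm_pos_iff.2 ((map_ne_zero (Classical.arbitrary (K →+* ℂ))).2 hx)).trans_le
    (norm_embedding_le_house x _)

theorem norm_embedding_unit_pos {K : Type*} [Field K] (u : (𝓞 K)ˣ) (φ : K →+* ℂ) : 0 < ‖φ (u : K)‖ :=
  norm_pos_iff.2 ((map_ne_zero φ).2 (Units.coe_ne_zero u))

theorem house_unit_le_exp_iff (u : (𝓞 K)ˣ) (T : ℝ) :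
    house (u : K) ≤ Real.exp T ↔ ∀ φ : K →+* ℂ, Real.log ‖φ (u : K)‖ ≤ T := by
  rw [house_le_iff]
  exact forall_congr' fun φ => (Real.log_le_iff_le_exp (norm_embedding_unit_pos u φ)).symm

theorem finite_houseBounded {β : K} (hβ : β ≠ 0) (F : Set (𝓞 K)ˣ) (N : ℝ) :
    (houseBounded β F N).Finite := by
  have h := Embeddings.finite_of_norm_le K ℂ (house β⁻¹ * N)
  refine Set.Finite.of_finite_image (f := fun u : (𝓞 K)ˣ => (u : K)) (h.subset ?_)
    (fun u _ v _ huv => Units.coe_injective K huv)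
  rintro _ ⟨u, ⟨-, hu⟩, rfl⟩
  refine ⟨RingOfIntegers.isIntegral_coe _, (house_le_iff _ _).1 ?_⟩
  calc house (u : K) = house (β⁻¹ * (β * (u : K))) := by rw [inv_mul_cancel_left₀ hβ]
    _ ≤ house β⁻¹ * house (β * (u : K)) := house_mul_le _ _
    _ ≤ house β⁻¹ * N := mul_le_mul_of_nonneg_left hu (house_nonneg _)

theorem exists_tendsto_ncard_houseBounded_one (hr : 0 < rank K) :
    ∃ c : ℝ, 0 < c ∧ Tendsto (fun T : ℝ =>
      ((houseBounded (1 : K) Set.univ (Real.exp T)).ncard : ℝ) / T ^ rank K) atTop (𝓝 c) := by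
  obtain ⟨c, hc, h⟩ := exists_tendsto_card_logRegion_inter_unitLattice hr
  refine ⟨Nat.card (torsion K) * c, mul_pos (by exact_mod_cast Nat.card_pos) hc, ?_⟩
  refine (h.const_mul _).congr fun T => ?_
  have h1 : houseBounded (1 : K) Set.univ (Real.exp T) =
      {u : (𝓞 K)ˣ | ∀ w : InfinitePlace K, Real.log (w (u : K)) ≤ T} := by
    ext u
    simp only [houseBounded, Set.mem_univ, true_and, one_mul, Set.mem_ofPred_eq,
      house_unit_le_exp_iff]
    refine ⟨fun h w => ?_, fun h φ => h (mk φ)⟩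
    rw [← norm_embedding_eq]
    exact h _
  rw [h1, ← Nat.card_coe_set_eq, card_units_log_le]
  push_cast
  ring

theorem tendsto_add_div_pow {f : ℝ → ℝ} {c : ℝ} {r : ℕ}
    (h : Tendsto (fun T => f T / T ^ r) atTop (𝓝 c)) (a : ℝ) :
    Tendsto (fun T => f (T + a) / T ^ r) atTop (𝓝 c) := by
  have h1 : Tendsto (fun T : ℝ => T + a) atTop atTop := tendsto_atTop_add_const_right _ a tendsto_id
  have h2 : Tendsto (fun T : ℝ => ((T + a) / T) ^ r) atTop (𝓝 1) := by
    have h3 : Tendsto (fun T : ℝ => 1 + a / T) atTop (𝓝 (1 + 0)) :=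
      tendsto_const_nhds.add (tendsto_const_nhds.div_atTop tendsto_id)
    have h4 := h3.pow r
    simp only [add_zero, one_pow] at h4
    refine h4.congr' ?_
    filter_upwards [eventually_gt_atTop 0] with T hT
    rw [add_div, div_self hT.ne']
  have h5 := (h.comp h1).mul h2
  rw [mul_one] at h5
  refine h5.congr' ?_
  filter_upwards [eventually_gt_atTop 0, eventually_gt_atTop (-a)] with T hT hTa
  have : 0 < T + a := by linarith
  simp only [Function.comp_apply, div_pow]
  field_simp

/-- Submultiplicativity of the house; used in both directions to compare an arbitrary nonzero
multiplier with `1`. -/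
theorem houseBounded_subset_of_mul {β γ : K} (F : Set (𝓞 K)ˣ) (T : ℝ)
    (hβ : β ≠ 0) (hγ : γ ≠ 0) :
    houseBounded β F (Real.exp T) ⊆
      houseBounded γ F (Real.exp (T + Real.log (house (γ * β⁻¹)))) := by
  rintro u ⟨hF, hu⟩
  refine ⟨hF, ?_⟩
  rw [Real.exp_add, Real.exp_log (house_pos (mul_ne_zero hγ (inv_ne_zero hβ)))]
  calc house (γ * (u : K)) = house ((β * (u : K)) * (γ * β⁻¹)) := by
        congr 1; field_simp
    _ ≤ house (β * (u : K)) * house (γ * β⁻¹) := house_mul_le _ _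
    _ ≤ _ := mul_le_mul_of_nonneg_right hu (house_nonneg _)

/-- The number of units `ε` with `house (β * ε) ≤ exp T` is asymptotically a positive multiple
of `T ^ rank K`. -/
theorem exists_tendsto_ncard_houseBounded_exp (hr : 0 < rank K) {β : K} (hβ : β ≠ 0) :
    ∃ c : ℝ, 0 < c ∧ Tendsto (fun T : ℝ =>
      ((houseBounded β Set.univ (Real.exp T)).ncard : ℝ) / T ^ rank K) atTop (𝓝 c) := by
  obtain ⟨c, hc, h⟩ := exists_tendsto_ncard_houseBounded_one (K := K) hr
  refine ⟨c, hc, tendsto_of_tendsto_of_tendsto_of_le_of_le'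
    (tendsto_add_div_pow (f := fun T => ((houseBounded (1 : K) Set.univ (Real.exp T)).ncard : ℝ)) h
      (-Real.log (house (β * 1⁻¹))))
    (tendsto_add_div_pow (f := fun T => ((houseBounded (1 : K) Set.univ (Real.exp T)).ncard : ℝ)) h
      (Real.log (house (1 * β⁻¹)))) ?_ ?_⟩
  · filter_upwards [eventually_ge_atTop 0] with T hT
    have h1 := houseBounded_subset_of_mul (K := K) Set.univ
      (T + -Real.log (house (β * 1⁻¹))) one_ne_zero hβ
    rw [neg_add_cancel_right] at h1
    have h2 := Set.ncard_le_ncard h1 (finite_houseBounded hβ _ _)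
    gcongr
  · filter_upwards [eventually_ge_atTop 0] with T hT
    have h2 := Set.ncard_le_ncard (houseBounded_subset_of_mul (K := K) Set.univ T hβ one_ne_zero)
      (finite_houseBounded one_ne_zero _ _)
    gcongr

theorem rank_pos_of_three_le (hd : 3 ≤ finrank ℚ K) : 0 < rank K := by
  classical
  have h1 : ∑ w : InfinitePlace K, mult w = finrank ℚ K := sum_mult_eq
  have h2 : ∑ w : InfinitePlace K, mult w ≤ ∑ w : InfinitePlace K, 2 :=
    Finset.sum_le_sum fun w _ => by rw [mult]; split_ifs <;> norm_num
  rw [Finset.sum_const, smul_eq_mul, Finset.card_univ] at h2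
  rw [rank]
  omega

end CountHouse

/-! ### Units close to a given direction. -/

section NearUnits

variable {K : Type*} [Field K] [NumberField K]

/-- The logarithms of the units at the infinite places come within bounded distance of every point
of a line in the trace zero hyperplane. -/
theorem exists_unit_abs_log_place_sub_le {v : InfinitePlace K → ℝ}
    (hv : ∑ w : InfinitePlace K, (mult w : ℝ) * v w = 0) :
    ∃ C : ℝ, ∀ t : ℝ, ∃ u : (𝓞 K)ˣ, ∀ w : InfinitePlace K,
      |Real.log (w (u : K)) - t * v w| ≤ C := by
  classical
  let x : logSpace K := fun w => mult w.1 * v w.1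
  have hx (w : InfinitePlace K) : placeForm w x = v w := by
    have hm : (mult w : ℝ) ≠ 0 := by exact_mod_cast mult_ne_zero
    apply mul_left_cancel₀ hm
    by_cases h : w = w₀
    · subst h
      rw [mult_mul_placeForm_w₀, neg_eq_iff_add_eq_zero, ← hv,
        Fintype.sum_eq_add_sum_subtype_ne _ w₀, add_comm]
    · exact mult_mul_placeForm_of_ne x ⟨w, h⟩
  let b := (basisUnitLattice K).ofZLatticeBasis ℝ (unitLattice K)
  have hb : Submodule.span ℤ (Set.range b) = unitLattice K :=
    (basisUnitLattice K).ofZLatticeBasis_span ℝ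
  let B : ℝ := ∑ i, ‖b i‖
  let A : InfinitePlace K → ℝ := fun w => ‖LinearMap.toContinuousLinearMap (placeForm w)‖
  have hA (w : InfinitePlace K) (y : logSpace K) : |placeForm w y| ≤ A w * ‖y‖ :=
    (LinearMap.toContinuousLinearMap (placeForm w)).le_opNorm y
  refine ⟨∑ w, A w * B, fun t => ?_⟩
  -- The required unit comes from rounding down in a lattice basis; the error is a fractional part,
  -- bounded independently of `t`.
  have hmem : ((ZSpan.floor b (t • x) : Submodule.span ℤ (Set.range b)) : logSpace K) ∈
      unitLattice K := hb ▸ (ZSpan.floor b (t • x)).2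
  obtain ⟨u, -, hu⟩ := hmem
  refine ⟨Additive.toMul u, fun w => ?_⟩
  have h1 : Real.log (w ((Additive.toMul u : (𝓞 K)ˣ) : K)) - t * v w =
      -placeForm w (ZSpan.fract b (t • x)) := by
    rw [← placeForm_logEmbedding, ZSpan.fract_apply, ← hu, map_sub, map_smul, hx, smul_eq_mul,
      neg_sub]
    rfl
  rw [h1, abs_neg]
  calc |placeForm w (ZSpan.fract b (t • x))| ≤ A w * ‖ZSpan.fract b (t • x)‖ := hA _ _
    _ ≤ A w * B := mul_le_mul_of_nonneg_left (ZSpan.norm_fract_le b _) (norm_nonneg _)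
    _ ≤ ∑ w, A w * B := Finset.single_le_sum (f := fun w => A w * B)
        (fun w _ => mul_nonneg (norm_nonneg _) (Finset.sum_nonneg fun i _ => norm_nonneg _))
        (Finset.mem_univ w)

theorem sum_mult_mul_eq_sum_embeddings (f : InfinitePlace K → ℝ) :
    ∑ w : InfinitePlace K, (mult w : ℝ) * f w = ∑ φ : K →+* ℂ, f (mk φ) := by
  classical
  rw [← Finset.sum_fiberwise_of_maps_to (s := Finset.univ) (t := Finset.univ) (g := mk)
    (fun _ _ => Finset.mem_univ _)]
  refine Finset.sum_congr rfl fun w _ => ?_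
  rw [Finset.sum_congr rfl (g := fun _ => f w)
    (fun φ hφ => by rw [(Finset.mem_filter.1 hφ).2]), Finset.sum_const, nsmul_eq_mul]
  congr 2
  exact (card_filter_mk_eq w).symm

/-- Invariance under conjugation is what lets `v` descend to the infinite places. -/
theorem exists_unit_abs_log_sub_le {v : (K →+* ℂ) → ℝ}
    (hconj : ∀ φ, v (ComplexEmbedding.conjugate φ) = v φ) (hsum : ∑ φ, v φ = 0) :
    ∃ C : ℝ, ∀ t : ℝ, ∃ u : (𝓞 K)ˣ, ∀ φ : K →+* ℂ,
      |Real.log ‖φ (u : K)‖ - t * v φ| ≤ C := by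
  have hv (φ : K →+* ℂ) : v (mk φ).embedding = v φ := by
    rcases embedding_mk_eq φ with h | h <;> rw [h]
    exact hconj φ
  obtain ⟨C, hC⟩ := exists_unit_abs_log_place_sub_le (K := K) (v := fun w => v w.embedding)
    (by rw [sum_mult_mul_eq_sum_embeddings]; simpa only [hv] using hsum)
  refine ⟨C, fun t => (hC t).imp fun u hu φ => ?_⟩
  have := hu (mk φ)
  rwa [hv] at this

theorem abs_log_norm_le_of_house_le {u : (𝓞 K)ˣ} {T : ℝ} (hT : 0 ≤ T)
    (hu : house (u : K) ≤ Real.exp T) (φ : K →+* ℂ) :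
    |Real.log ‖φ (u : K)‖| ≤ finrank ℚ K * T := by
  rw [house_unit_le_exp_iff] at hu
  refine neg_le_of_sum_mult_mul_eq_zero (f := fun w => Real.log (w (u : K)))
    (sum_mult_mul_log u) hT (fun w => ?_) (mk φ)
  rw [← norm_embedding_eq]
  exact hu _

/-- The units whose vector of logarithms is within `δ * n` of `n * v`. -/
def nearUnits (v : (K →+* ℂ) → ℝ) (δ n : ℝ) : Set (𝓞 K)ˣ :=
  {u | ∀ φ : K →+* ℂ, |Real.log ‖φ (u : K)‖ - n * v φ| ≤ δ * n}

theorem finite_nearUnits (v : (K →+* ℂ) → ℝ) (δ n : ℝ) : (nearUnits v δ n).Finite := by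
  refine (finite_houseBounded (one_ne_zero (α := K)) Set.univ
    (Real.exp (∑ φ, |n * v φ| + δ * n))).subset fun u hu => ⟨trivial, ?_⟩
  rw [one_mul, house_unit_le_exp_iff]
  intro φ
  have h1 := (abs_le.1 (hu φ)).2
  have h2 := Finset.single_le_sum (f := fun φ => |n * v φ|) (fun φ _ => abs_nonneg _)
    (Finset.mem_univ φ)
  have h3 := le_abs_self (n * v φ)
  linarith

theorem ncard_le_card_mul_ncard_image {G α : Type*} [Group G] (H : Subgroup G) [Finite H]
    {A : Set G} (hA : A.Finite) (f : G → α) (hf : ∀ a b, f a = f b → a * b⁻¹ ∈ H) :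
    A.ncard ≤ Nat.card H * (f '' A).ncard := by
  classical
  rw [← Nat.card_coe_set_eq, ← Nat.card_coe_set_eq, ← Nat.card_prod]
  have : Finite (f '' A) := hA.image f
  choose g hgA hg using fun y : f '' A => y.2
  refine Nat.card_le_card_of_injective (fun a : A =>
    ((⟨a.1 * (g ⟨f a, a, a.2, rfl⟩)⁻¹, hf _ _ (hg ⟨f a, a, a.2, rfl⟩).symm⟩ : H),
      (⟨f a, a, a.2, rfl⟩ : f '' A))) fun a b hab => ?_
  simp only [Prod.mk.injEq, Subtype.mk.injEq] at hab
  obtain ⟨h1, h2⟩ := hab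
  simp only [h2] at h1
  exact Subtype.ext (mul_right_cancel h1)

/-- Multiply one unit near `(n / m) * v` by all units of house at most `exp (κ * n)` and take `m`-th
powers. Powering merges only units differing by torsion, so the count keeps its order of magnitude.
-/
theorem exists_mul_pow_le_ncard_nearUnits (hr : 0 < rank K) {v : (K →+* ℂ) → ℝ}
    (hconj : ∀ φ, v (ComplexEmbedding.conjugate φ) = v φ) (hsum : ∑ φ, v φ = 0)
    {δ : ℝ} (hδ : 0 < δ) {m : ℕ} (hm : 0 < m) :
    ∃ c : ℝ, 0 < c ∧ ∀ᶠ n : ℝ in atTop,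
      c * n ^ rank K ≤ ((nearUnits v δ n ∩ Set.range (· ^ m) : Set (𝓞 K)ˣ).ncard : ℝ) := by
  obtain ⟨c, hc, hlim⟩ := exists_tendsto_ncard_houseBounded_one (K := K) hr
  obtain ⟨C, hC⟩ := exists_unit_abs_log_sub_le hconj hsum
  have hd : (0 : ℝ) < finrank ℚ K := by exact_mod_cast finrank_pos (R := ℚ) (M := K)
  have hm' : (0 : ℝ) < m := by exact_mod_cast hm
  have hτ : (0 : ℝ) < Nat.card (torsion K) := by exact_mod_cast Nat.card_pos
  -- Chosen so that the small factor, raised to the power `m`, moves each logarithm by at most `δ *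
  -- n / 2`; the other half absorbs `m * C` once `n ≥ 2 * m * C / δ`.
  let κ : ℝ := δ / (2 * finrank ℚ K) / m
  have hκ : 0 < κ := by positivity
  refine ⟨c / 2 * κ ^ rank K / Nat.card (torsion K), by positivity, ?_⟩
  have h1 : Tendsto (fun n : ℝ => κ * n) atTop atTop := tendsto_id.const_mul_atTop hκ
  have h2 := h1.eventually (hlim.eventually_const_le (half_lt_self hc))
  filter_upwards [h2, eventually_gt_atTop 0, eventually_ge_atTop (2 * m * C / δ)] with n hn hn0 hnC
  rw [div_le_iff₀ hδ] at hnC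
  have hκn : 0 < κ * n := by positivity
  rw [le_div_iff₀ (by positivity), mul_pow, ← mul_assoc] at hn
  obtain ⟨u, hu⟩ := hC (n / m)
  let A : Set (𝓞 K)ˣ := houseBounded (1 : K) Set.univ (Real.exp (κ * n))
  have hA : A.Finite := finite_houseBounded one_ne_zero _ _
  have hsub : (fun x => (u * x) ^ m) '' A ⊆ nearUnits v δ n ∩ Set.range (· ^ m) := by
    rintro _ ⟨x, ⟨-, hx⟩, rfl⟩
    refine ⟨fun φ => ?_, u * x, rfl⟩
    rw [one_mul] at hx
    have hx' := abs_log_norm_le_of_house_le hκn.le hx φ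
    have e1 : Real.log ‖φ (((u * x) ^ m : (𝓞 K)ˣ) : K)‖ - n * v φ =
        m * ((Real.log ‖φ (u : K)‖ - n / m * v φ) + Real.log ‖φ (x : K)‖) := by
      simp only [Units.coe_pow, Units.coe_mul, map_pow, map_mul, norm_pow, norm_mul, Real.log_pow]
      rw [Real.log_mul (norm_embedding_unit_pos u φ).ne' (norm_embedding_unit_pos x φ).ne']
      field_simp
      ring
    have e2 : (m : ℝ) * (finrank ℚ K * (κ * n)) = δ * n / 2 := by
      simp only [κ]; field_simp
    rw [e1, abs_mul, Nat.abs_cast]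
    calc (m : ℝ) * |(Real.log ‖φ (u : K)‖ - n / m * v φ) + Real.log ‖φ (x : K)‖|
        ≤ m * (C + finrank ℚ K * (κ * n)) := by
          gcongr
          exact (abs_add_le _ _).trans (add_le_add (hu φ) hx')
      _ = m * C + δ * n / 2 := by rw [mul_add, e2]
      _ ≤ δ * n := by linarith
  have h3 : A.ncard ≤ Nat.card (torsion K) * ((fun x => (u * x) ^ m) '' A).ncard := by
    refine ncard_le_card_mul_ncard_image (torsion K) hA _ fun a b hab => ?_
    rw [torsion, CommGroup.mem_torsion, isOfFinOrder_iff_pow_eq_one]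
    refine ⟨m, hm, ?_⟩
    simp only [mul_pow, mul_left_cancel_iff] at hab
    rw [mul_pow, hab, inv_pow, mul_inv_cancel]
  have h4 := Set.ncard_le_ncard hsub ((finite_nearUnits v δ n).subset Set.inter_subset_left)
  have h5 : (A.ncard : ℝ) ≤ Nat.card (torsion K) *
      ((nearUnits v δ n ∩ Set.range (· ^ m) : Set (𝓞 K)ˣ).ncard : ℝ) := by
    exact_mod_cast h3.trans (Nat.mul_le_mul_left _ h4)
  rw [div_mul_eq_mul_div, div_le_iff₀ hτ, mul_comm _ (Nat.card (torsion K) : ℝ)]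
  exact hn.trans h5

end NearUnits

/-! ### Units whose multiples fall in a subfield. -/

section Subfields

variable {K : Type*} [Field K] [NumberField K]

/-- The units of `K` that lie in the subfield `F`. -/
def unitsIn (F : IntermediateField ℚ K) : Subgroup (𝓞 K)ˣ where
  carrier := {u | (u : K) ∈ F}
  mul_mem' {a b} ha hb := by
    simp only [Set.mem_ofPred_eq, Units.coe_mul] at *
    exact F.mul_mem ha hb
  one_mem' := by simp
  inv_mem' {a} ha := by
    have : ((a⁻¹ : (𝓞 K)ˣ) : K) = (a : K)⁻¹ := by simp
    simp only [Set.mem_ofPred_eq, this] at *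
    exact F.inv_mem ha

theorem mem_unitsIn {F : IntermediateField ℚ K} {u : (𝓞 K)ˣ} : u ∈ unitsIn F ↔ (u : K) ∈ F :=
  Iff.rfl

/-- If the units in `F` have infinite index, then the units `ε` with `β * ε ∈ F` have density
zero. -/
theorem eventually_ncard_houseBounded_le_of_index_eq_zero (hr : 0 < rank K) {β : K} (hβ : β ≠ 0)
    {F : IntermediateField ℚ K} (hF : (unitsIn F).index = 0) {e : ℝ} (he : 0 < e) :
    ∀ᶠ T : ℝ in atTop,
      ((houseBounded β {u : (𝓞 K)ˣ | β * (u : K) ∈ F} (Real.exp T)).ncard : ℝ) ≤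
        e * T ^ rank K := by
  obtain ⟨c, hc, hlim⟩ := exists_tendsto_ncard_houseBounded_exp hr hβ
  -- With `M` disjoint translates inside a set of at most `(c + 1) * T ^ rank K` units, each has at
  -- most `e * T ^ rank K` elements.
  obtain ⟨M, hM⟩ := exists_nat_gt ((c + 1) / e)
  have hM0 : (0 : ℝ) < M := lt_trans (by positivity) hM
  have : Infinite ((𝓞 K)ˣ ⧸ unitsIn F) := Subgroup.index_eq_zero_iff_infinite.1 hF
  let q : ℕ ↪ (𝓞 K)ˣ ⧸ unitsIn F := Infinite.natEmbedding _
  let η : Fin M → (𝓞 K)ˣ := fun i => (q i).out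
  have hη (i j : Fin M) (h : (η i)⁻¹ * η j ∈ unitsIn F) : i = j := by
    have h1 := QuotientGroup.eq.2 h
    simp only [η, QuotientGroup.out_eq'] at h1
    exact Fin.ext (q.injective h1)
  let D : ℝ := ∑ i, |Real.log (house (η i : K))|
  have hD (i : Fin M) : house (η i : K) ≤ Real.exp D := by
    rw [← Real.log_le_iff_le_exp (house_pos (Units.coe_ne_zero _))]
    exact (le_abs_self _).trans (Finset.single_le_sum
      (f := fun i => |Real.log (house (η i : K))|) (fun i _ => abs_nonneg _) (Finset.mem_univ i))
  filter_upwards [(tendsto_add_div_pow (f := fun T =>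
      ((houseBounded β Set.univ (Real.exp T)).ncard : ℝ)) hlim D).eventually_le_const
      (lt_add_one c), eventually_gt_atTop 0] with T hT hT0
  rw [div_le_iff₀ (by positivity)] at hT
  let S : Set (𝓞 K)ˣ := houseBounded β {u : (𝓞 K)ˣ | β * (u : K) ∈ F} (Real.exp T)
  let R : Set (𝓞 K)ˣ := houseBounded β Set.univ (Real.exp (T + D))
  have hmem (i : Fin M) (u : (𝓞 K)ˣ) (hu : u ∈ S) : η i * u ∈ R := by
    refine ⟨trivial, ?_⟩
    calc house (β * ((η i * u : (𝓞 K)ˣ) : K)) = house ((β * (u : K)) * (η i : K)) := by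
          rw [Units.coe_mul]; congr 1; ring
      _ ≤ house (β * (u : K)) * house (η i : K) := house_mul_le _ _
      _ ≤ Real.exp T * Real.exp D :=
          mul_le_mul hu.2 (hD i) (house_nonneg _) (Real.exp_pos _).le
      _ = Real.exp (T + D) := (Real.exp_add _ _).symm
  have : Finite R := finite_houseBounded hβ _ _
  have h1 : M * S.ncard ≤ R.ncard := by
    rw [← Nat.card_coe_set_eq, ← Nat.card_coe_set_eq]
    conv_lhs => rw [← Nat.card_fin M, ← Nat.card_prod]
    refine Nat.card_le_card_of_injective
      (fun p : Fin M × S => (⟨η p.1 * p.2, hmem p.1 p.2 p.2.2⟩ : R)) ?_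
    rintro ⟨i, a, ha⟩ ⟨j, b, hb⟩ hab
    simp only [Subtype.mk.injEq] at hab
    -- Translates by distinct cosets are disjoint: `a * b⁻¹` is a quotient of two elements of `F`,
    -- as `β` cancels.
    have h2 : (η i)⁻¹ * η j = a * b⁻¹ := by
      rw [inv_mul_eq_iff_eq_mul, ← mul_assoc, eq_mul_inv_iff_mul_eq, hab]
    have hij : i = j := by
      refine hη i j ?_
      rw [h2, mem_unitsIn]
      have h3 : ((a * b⁻¹ : (𝓞 K)ˣ) : K) = (β * (a : K)) * (β * (b : K))⁻¹ := by
        have : (b : K) ≠ 0 := Units.coe_ne_zero b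
        rw [Units.coe_mul]
        simp
        field_simp
      rw [h3]
      exact F.mul_mem ha.1 (F.inv_mem hb.1)
    subst hij
    simpa using hab
  have h2 : (M : ℝ) * S.ncard ≤ (c + 1) * T ^ rank K := (by exact_mod_cast h1 : _ ≤ _).trans hT
  rw [div_lt_iff₀ he] at hM
  have h3 : (c + 1) * T ^ rank K ≤ M * (e * T ^ rank K) := by
    rw [← mul_assoc]
    gcongr
  exact le_of_mul_le_mul_left (h2.trans h3) hM0

end Subfields

/-! ### Conjugation-invariant directions with repeated extrema. -/

section Directions

theorem exists_subset_card_two_of_involutive {X : Type*} [DecidableEq X] {σ : X → X}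
    (hσ : Function.Involutive σ) {T : Finset X} (hT : ∀ x ∈ T, σ x ∈ T) (h2 : 2 ≤ T.card) :
    ∃ A ⊆ T, A.card = 2 ∧ ∀ x, σ x ∈ A ↔ x ∈ A := by
  suffices h : ∃ A ⊆ T, A.card = 2 ∧ ∀ x ∈ A, σ x ∈ A by
    obtain ⟨A, hA, hc, h⟩ := h
    exact ⟨A, hA, hc, fun x => ⟨fun hx => hσ x ▸ h _ hx, h x⟩⟩
  by_cases h : ∃ x ∈ T, σ x ≠ x
  · obtain ⟨x, hx, hne⟩ := h
    refine ⟨{x, σ x}, ?_, Finset.card_pair hne.symm, ?_⟩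
    · simp [Finset.insert_subset_iff, hx, hT x hx]
    · simp [hσ x]
  · push Not at h
    obtain ⟨A, hA, hc⟩ := Finset.exists_subset_card_eq h2
    exact ⟨A, hA, hc, fun x hx => by rwa [h x (hA hx)]⟩

/-- An involution on a set with at least three elements admits an invariant function of sum zero
that attains its maximum `1` at least twice. -/
theorem exists_invariant_sum_eq_zero_two_max {X : Type*} [Fintype X] {σ : X → X}
    (hσ : Function.Involutive σ) (h3 : 3 ≤ Fintype.card X) :
    ∃ v : X → ℝ, (∀ x, v (σ x) = v x) ∧ ∑ x, v x = 0 ∧ (∀ x, v x ≤ 1) ∧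
      ∃ x y, x ≠ y ∧ v x = 1 ∧ v y = 1 := by
  classical
  obtain ⟨A, -, hc, hA⟩ := exists_subset_card_two_of_involutive hσ (T := Finset.univ)
    (fun _ _ => Finset.mem_univ _) (by rw [Finset.card_univ]; omega)
  have hcc : 0 < Aᶜ.card := by rw [Finset.card_compl]; omega
  have hcc' : (0 : ℝ) < Aᶜ.card := by exact_mod_cast hcc
  refine ⟨fun x => if x ∈ A then 1 else -(2 / Aᶜ.card), fun x => by simp [hA], ?_, fun x => ?_, ?_⟩
  · rw [← Finset.sum_add_sum_compl A, Finset.sum_congr rfl (g := fun _ => (1 : ℝ))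
      (fun x hx => if_pos hx), Finset.sum_congr rfl (s₁ := Aᶜ) (g := fun _ => -(2 / (Aᶜ.card : ℝ)))
      (fun x hx => if_neg (Finset.mem_compl.1 hx)), Finset.sum_const, Finset.sum_const, hc,
      nsmul_eq_mul, nsmul_eq_mul]
    field_simp
    norm_num
  · dsimp only
    split_ifs
    · exact le_rfl
    · have : 0 < 2 / (Aᶜ.card : ℝ) := by positivity
      linarith
  · obtain ⟨x, y, hxy, rfl⟩ := Finset.card_eq_two.1 hc
    exact ⟨x, y, hxy, by simp, by simp⟩

/-- An involution on a set with at least four elements admits an invariant function of sum zero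
that attains its maximum `1` and its minimum `-1` at least twice. -/
theorem exists_invariant_sum_eq_zero_two_max_two_min {X : Type*} [Fintype X] {σ : X → X}
    (hσ : Function.Involutive σ) (h4 : 4 ≤ Fintype.card X) :
    ∃ v : X → ℝ, (∀ x, v (σ x) = v x) ∧ ∑ x, v x = 0 ∧ (∀ x, v x ≤ 1) ∧ (∀ x, -v x ≤ 1) ∧
      (∃ x y, x ≠ y ∧ v x = 1 ∧ v y = 1) ∧ ∃ x y, x ≠ y ∧ -v x = 1 ∧ -v y = 1 := by
  classical
  obtain ⟨A, -, hc, hA⟩ := exists_subset_card_two_of_involutive hσ (T := Finset.univ)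
    (fun _ _ => Finset.mem_univ _) (by rw [Finset.card_univ]; omega)
  obtain ⟨B, hB, hcB, hσB⟩ := exists_subset_card_two_of_involutive hσ (T := Aᶜ)
    (fun x hx => by simpa [hA] using hx) (by rw [Finset.card_compl]; omega)
  have hd (x : X) (hx : x ∈ B) : x ∉ A := Finset.mem_compl.1 (hB hx)
  refine ⟨fun x => (if x ∈ A then 1 else 0) - (if x ∈ B then 1 else 0), fun x => by simp [hA, hσB],
    ?_, fun x => ?_, fun x => ?_, ?_, ?_⟩
  · rw [Finset.sum_sub_distrib]
    simp [hc, hcB]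
  · dsimp only
    split_ifs <;> norm_num
  · dsimp only
    split_ifs <;> norm_num
  · obtain ⟨x, y, hxy, rfl⟩ := Finset.card_eq_two.1 hc
    have hx : x ∉ B := fun h => hd x h (by simp)
    have hy : y ∉ B := fun h => hd y h (by simp)
    exact ⟨x, y, hxy, by simp [hx], by simp [hy]⟩
  · obtain ⟨x, y, hxy, rfl⟩ := Finset.card_eq_two.1 hcB
    have hx : x ∉ A := hd x (by simp)
    have hy : y ∉ A := hd y (by simp)
    exact ⟨x, y, hxy, by simp [hx], by simp [hy]⟩

end Directions

/-! ### Generating units near a direction and their density. -/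

section Generating

variable {K : Type*} [Field K] [NumberField K]

/-- There are finitely many intermediate fields, so the product of the finite indices serves them
all. -/
theorem exists_pow_mem_unitsIn (K : Type*) [Field K] [NumberField K] :
    ∃ m : ℕ, 0 < m ∧ ∀ F : IntermediateField ℚ K, (unitsIn F).index ≠ 0 →
      ∀ x : (𝓞 K)ˣ, x ^ m ∈ unitsIn F := by
  classical
  have := Field.finite_intermediateField_of_exists_primitive_element ℚ K
    (Field.exists_primitive_element ℚ K)
  have := Fintype.ofFinite (IntermediateField ℚ K)
  refine ⟨∏ F : IntermediateField ℚ K, if (unitsIn F).index = 0 then 1 else (unitsIn F).index,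
    Finset.prod_pos fun F _ => ?_, fun F hF x => ?_⟩
  · split_ifs with h
    · exact one_pos
    · exact Nat.pos_of_ne_zero h
  · have h := Finset.dvd_prod_of_mem
      (fun F : IntermediateField ℚ K => if (unitsIn F).index = 0 then 1 else (unitsIn F).index)
      (Finset.mem_univ F)
    rw [if_neg hF] at h
    obtain ⟨k, hk⟩ := h
    rw [hk, pow_mul]
    exact (unitsIn F).pow_mem ((unitsIn F).pow_index_mem x) k

theorem eventually_nearUnits_subset_houseBounded {β : K} (hβ : β ≠ 0) {v : (K →+* ℂ) → ℝ}
    (hv : ∀ φ, v φ ≤ 1) {δ : ℝ} (hδ : δ < 1) :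
    ∀ᶠ n : ℝ in atTop, nearUnits v δ n ⊆ houseBounded β Set.univ (Real.exp (3 * n)) := by
  filter_upwards [eventually_ge_atTop 0, eventually_ge_atTop (Real.log (house β))]
    with n hn hnβ u hu
  have hβ' : house β ≤ Real.exp n := (Real.log_le_iff_le_exp (house_pos hβ)).1 hnβ
  have hu' : house (u : K) ≤ Real.exp (2 * n) := by
    rw [house_unit_le_exp_iff]
    intro φ
    have h1 := (abs_le.1 (hu φ)).2
    nlinarith [hv φ]
  refine ⟨trivial, (house_mul_le _ _).trans ?_⟩
  -- One `n` pays for `house β`, the other two for `1 + δ < 2`.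
  rw [show 3 * n = n + 2 * n by ring, Real.exp_add]
  exact mul_le_mul hβ' hu' (house_nonneg _) (Real.exp_pos _).le

theorem exists_mul_pow_le_ncard_nearUnits_inter_generatingUnits (hr : 0 < rank K) {α : K}
    (hα0 : α ≠ 0) (hα : ℚ⟮α⟯ = ⊤) {v : (K →+* ℂ) → ℝ}
    (hconj : ∀ φ, v (ComplexEmbedding.conjugate φ) = v φ) (hsum : ∑ φ, v φ = 0)
    (hv : ∀ φ, v φ ≤ 1) {δ : ℝ} (hδ : 0 < δ) (hδ1 : δ < 1) :
    ∃ c : ℝ, 0 < c ∧ ∀ᶠ n : ℝ in atTop,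
      c * n ^ rank K ≤ ((nearUnits v δ n ∩ generatingUnits α).ncard : ℝ) := by
  classical
  have := Field.finite_intermediateField_of_exists_primitive_element ℚ K
    (Field.exists_primitive_element ℚ K)
  have := Fintype.ofFinite (IntermediateField ℚ K)
  obtain ⟨m, hm, hpow⟩ := exists_pow_mem_unitsIn K
  obtain ⟨c, hc, hlow⟩ := exists_mul_pow_le_ncard_nearUnits hr hconj hsum hδ hm
  let 𝓕 : Finset (IntermediateField ℚ K) := Finset.univ.filter fun F => (unitsIn F).index = 0
  -- Makes the bad sets together cost at most half of the main term `c * n ^ rank K`; the factor `3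
  -- ^ rank K` reflects the radius `exp (3 * n)`.
  let e : ℝ := c / (2 * (𝓕.card + 1) * 3 ^ rank K)
  have he : 0 < e := by positivity
  let bad (F : IntermediateField ℚ K) (n : ℝ) : Set (𝓞 K)ˣ :=
    houseBounded α {u : (𝓞 K)ˣ | α * (u : K) ∈ F} (Real.exp (3 * n))
  have hbad : ∀ᶠ n : ℝ in atTop, ∀ F ∈ 𝓕, ((bad F n).ncard : ℝ) ≤ e * (3 * n) ^ rank K := by
    rw [Filter.eventually_all_finset]
    intro F hF
    exact (tendsto_id.const_mul_atTop (zero_lt_three' ℝ)).eventually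
      (eventually_ncard_houseBounded_le_of_index_eq_zero hr hα0 (Finset.mem_filter.1 hF).2 he)
  refine ⟨c / 2, half_pos hc, ?_⟩
  filter_upwards [hlow, hbad, eventually_nearUnits_subset_houseBounded hα0 hv hδ1,
    eventually_ge_atTop 0] with n h1 h2 h3 hn
  have hcover : nearUnits v δ n ∩ Set.range (· ^ m) ⊆
      (nearUnits v δ n ∩ generatingUnits α) ∪ ⋃ F ∈ 𝓕, bad F n := by
    rintro _ ⟨hu, x, rfl⟩
    by_cases hg : (x ^ m) ∈ generatingUnits α
    · exact Or.inl ⟨hu, hg⟩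
    · refine Or.inr ?_
      let F : IntermediateField ℚ K := ℚ⟮α * ((x ^ m : (𝓞 K)ˣ) : K)⟯
      have hmem : α * ((x ^ m : (𝓞 K)ˣ) : K) ∈ F := mem_adjoin_simple_self ℚ _
      -- With finite index, the `m`-th power would lie in `F`, and dividing by it would put the
      -- generator `α` in `F`.
      have hF : (unitsIn F).index = 0 := by
        by_contra hne
        have hx : ((x ^ m : (𝓞 K)ˣ) : K) ∈ F := hpow F hne x
        apply hg
        have hα' : α ∈ F := by
          have := F.mul_mem hmem (F.inv_mem hx)
          rwa [mul_inv_cancel_right₀ (Units.coe_ne_zero _)] at this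
        change F = ⊤
        rw [eq_top_iff, ← hα]
        exact adjoin_simple_le_iff.2 hα'
      simp only [Set.mem_iUnion]
      exact ⟨F, Finset.mem_filter.2 ⟨Finset.mem_univ _, hF⟩, hmem, (h3 hu).2⟩
  have hfin : ((nearUnits v δ n ∩ generatingUnits α) ∪ ⋃ F ∈ 𝓕, bad F n).Finite :=
    ((finite_nearUnits v δ n).subset Set.inter_subset_left).union
      (𝓕.finite_toSet.biUnion fun F _ => finite_houseBounded hα0 _ _)
  have h4 : (nearUnits v δ n ∩ Set.range (· ^ m)).ncard ≤
      (nearUnits v δ n ∩ generatingUnits α).ncard + ∑ F ∈ 𝓕, (bad F n).ncard :=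
    (Set.ncard_le_ncard hcover hfin).trans ((Set.ncard_union_le _ _).trans
      (Nat.add_le_add_left (Finset.set_ncard_biUnion_le _ _) _))
  have h5 : ((nearUnits v δ n ∩ Set.range (· ^ m) : Set (𝓞 K)ˣ).ncard : ℝ) ≤
      (nearUnits v δ n ∩ generatingUnits α).ncard + ∑ F ∈ 𝓕, ((bad F n).ncard : ℝ) := by
    exact_mod_cast h4
  have h6 : ∑ F ∈ 𝓕, ((bad F n).ncard : ℝ) ≤ 𝓕.card * (e * (3 * n) ^ rank K) := by
    rw [← nsmul_eq_mul]
    exact Finset.sum_le_card_nsmul _ _ _ h2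
  have h7 : (𝓕.card : ℝ) * (e * (3 * n) ^ rank K) ≤ c / 2 * n ^ rank K := by
    have h8 : ((𝓕.card : ℝ) + 1) * (e * (3 * n) ^ rank K) = c / 2 * n ^ rank K := by
      simp only [e, mul_pow]
      field_simp
    rw [← h8]
    have : 0 ≤ e * (3 * n) ^ rank K := by positivity
    nlinarith
  linarith

theorem eventually_nearUnits_inter_generatingUnits_subset_twoLargeUnits {β : K} (hβ : β ≠ 0)
    {v : (K →+* ℂ) → ℝ} (hv : ∀ φ, v φ ≤ 1) (h2 : ∃ φ₁ φ₂, φ₁ ≠ φ₂ ∧ v φ₁ = 1 ∧ v φ₂ = 1)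
    {ν : ℝ} (hν0 : 0 < ν) (hν1 : ν < 1) :
    ∀ᶠ n : ℝ in atTop,
      nearUnits v ((1 - ν) / 8) n ∩ generatingUnits β ⊆ twoLargeUnits β ν := by
  let δ : ℝ := (1 - ν) / 8
  have hδ : 0 < δ := by simp only [δ]; linarith
  let D : ℝ := ∑ φ : K →+* ℂ, |Real.log ‖φ β‖|
  have hD (φ : K →+* ℂ) : |Real.log ‖φ β‖| ≤ D :=
    Finset.single_le_sum (f := fun φ : K →+* ℂ => |Real.log ‖φ β‖|)
      (fun _ _ => abs_nonneg _) (Finset.mem_univ φ)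
  filter_upwards [eventually_ge_atTop 0, eventually_ge_atTop (D / δ)] with n hn hnD
  rintro u ⟨hu, hg⟩
  rw [div_le_iff₀ hδ] at hnD
  have hpos (φ : K →+* ℂ) : 0 < ‖φ (β * (u : K))‖ :=
    norm_pos_iff.2 ((map_ne_zero φ).2 (mul_ne_zero hβ (Units.coe_ne_zero u)))
  have hlog (φ : K →+* ℂ) : |Real.log ‖φ (β * (u : K))‖ - n * v φ| ≤ 2 * δ * n := by
    rw [map_mul, norm_mul, Real.log_mul (norm_pos_iff.2 ((map_ne_zero φ).2 hβ)).ne'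
      (norm_embedding_unit_pos u φ).ne', add_sub_assoc]
    refine (abs_add_le _ _).trans ?_
    have h1 : |Real.log ‖φ (u : K)‖ - n * v φ| ≤ δ * n := hu φ
    linarith [hD φ]
  have hhouse : house (β * (u : K)) ≤ Real.exp ((1 + 2 * δ) * n) := by
    rw [house_le_iff]
    intro φ
    rw [← Real.log_le_iff_le_exp (hpos φ)]
    have h1 := (abs_le.1 (hlog φ)).2
    nlinarith [hv φ]
  have hlarge (φ : K →+* ℂ) (hφ : v φ = 1) :
      house (β * (u : K)) ^ ν ≤ ‖φ (β * (u : K))‖ := by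
    calc house (β * (u : K)) ^ ν ≤ Real.exp ((1 + 2 * δ) * n) ^ ν :=
          Real.rpow_le_rpow (house_nonneg _) hhouse hν0.le
      _ = Real.exp ((1 + 2 * δ) * n * ν) := (Real.exp_mul _ _).symm
      _ ≤ ‖φ (β * (u : K))‖ := by
          rw [← Real.le_log_iff_exp_le (hpos φ)]
          have h1 := (abs_le.1 (hlog φ)).1
          rw [hφ, mul_one] at h1
          -- Equivalent to `2 * δ * (1 + ν) ≤ 1 - ν`, which the choice `δ = (1 - ν) / 8` leaves room
          -- for.
          have h3 : (1 + 2 * δ) * ν ≤ 1 - 2 * δ := by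
            simp only [δ]
            nlinarith
          nlinarith
  obtain ⟨ψ, hψ⟩ := exists_norm_embedding_eq_house (β * (u : K))
  obtain ⟨φ₁, φ₂, hne, h1, h2⟩ := h2
  refine ⟨hg, ?_⟩
  -- The house may be attained at an embedding other than `φ₁` and `φ₂`; at least one of these two
  -- differs from it.
  by_cases h : ψ = φ₁
  · exact ⟨ψ, φ₂, h ▸ hne, hψ, hlarge φ₂ h2⟩
  · exact ⟨ψ, φ₁, h, hψ, hlarge φ₁ h1⟩

theorem inv_mem_nearUnits {K : Type*} [Field K] {v : (K →+* ℂ) → ℝ} {δ n : ℝ} {u : (𝓞 K)ˣ} (hu : u ∈ nearUnits v δ n) :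
    u⁻¹ ∈ nearUnits (-v) δ n := by
  intro φ
  have h : Real.log ‖φ ((u⁻¹ : (𝓞 K)ˣ) : K)‖ - n * (-v) φ =
      -(Real.log ‖φ (u : K)‖ - n * v φ) := by
    have : ((u⁻¹ : (𝓞 K)ˣ) : K) = (u : K)⁻¹ := by simp
    rw [this, map_inv₀, norm_inv, Real.log_inv, Pi.neg_apply]
    ring
  rw [h, abs_neg]
  exact hu φ

theorem inv_mem_generatingUnits {α : K} {u : (𝓞 K)ˣ} (hu : u ∈ generatingUnits α) :
    u⁻¹ ∈ generatingUnits α⁻¹ := by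
  have h : α⁻¹ * ((u⁻¹ : (𝓞 K)ˣ) : K) = (α * (u : K))⁻¹ := by simp [mul_comm]
  have hu' : ℚ⟮α * (u : K)⟯ = ⊤ := hu
  change ℚ⟮α⁻¹ * ((u⁻¹ : (𝓞 K)ˣ) : K)⟯ = ⊤
  rw [h, eq_top_iff, ← hu', adjoin_simple_le_iff]
  simpa using inv_mem (mem_adjoin_simple_self ℚ (α * (u : K))⁻¹)

/-- A set of units that eventually contains the generating units near the multiples of a direction
`v` has positive lower density. -/
theorem exists_eventually_le_ncard_houseBounded_div (hr : 0 < rank K) {α : K}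
    (hα0 : α ≠ 0) (hα : ℚ⟮α⟯ = ⊤) {v : (K →+* ℂ) → ℝ}
    (hconj : ∀ φ, v (ComplexEmbedding.conjugate φ) = v φ) (hsum : ∑ φ, v φ = 0)
    (hv : ∀ φ, v φ ≤ 1) {δ : ℝ} (hδ : 0 < δ) (hδ1 : δ < 1) {F : Set (𝓞 K)ˣ}
    (hF : ∀ᶠ n : ℝ in atTop, nearUnits v δ n ∩ generatingUnits α ⊆ F) :
    ∃ c : ℝ, 0 < c ∧ ∀ᶠ N : ℝ in atTop,
      c ≤ ((houseBounded α F N).ncard : ℝ) / Real.log N ^ rank K := by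
  obtain ⟨c, hc, h⟩ :=
    exists_mul_pow_le_ncard_nearUnits_inter_generatingUnits hr hα0 hα hconj hsum hv hδ hδ1
  refine ⟨c / 3 ^ rank K, by positivity, ?_⟩
  have hlog : Tendsto (fun N : ℝ => Real.log N / 3) atTop atTop :=
    Real.tendsto_log_atTop.atTop_div_const three_pos
  filter_upwards [hlog.eventually (h.and (hF.and
    (eventually_nearUnits_subset_houseBounded hα0 hv hδ1))), eventually_gt_atTop 1] with N hN hN1
  obtain ⟨h1, h2, h3⟩ := hN
  have hl := Real.log_pos hN1
  rw [mul_div_cancel₀ _ (three_ne_zero' ℝ), Real.exp_log (by linarith)] at h3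
  have h4 : nearUnits v δ (Real.log N / 3) ∩ generatingUnits α ⊆ houseBounded α F N :=
    fun u hu => ⟨h2 hu, (h3 hu.1).2⟩
  have h5 := Set.ncard_le_ncard h4 (finite_houseBounded hα0 _ _)
  rw [le_div_iff₀ (by positivity)]
  calc c / 3 ^ rank K * Real.log N ^ rank K = c * (Real.log N / 3) ^ rank K := by
        rw [div_pow]; ring
    _ ≤ _ := h1
    _ ≤ _ := by exact_mod_cast h5

theorem exists_eventually_le_ncard_twoLargeUnits_div (hd : 3 ≤ finrank ℚ K) {α : K}
    (hα0 : α ≠ 0) (hα : ℚ⟮α⟯ = ⊤) {ν : ℝ} (hν0 : 0 < ν) (hν1 : ν < 1) :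
    ∃ c : ℝ, 0 < c ∧ ∀ᶠ N : ℝ in atTop,
      c ≤ ((houseBounded α (twoLargeUnits α ν) N).ncard : ℝ) / Real.log N ^ rank K := by
  obtain ⟨v, hconj, hsum, hv, h2⟩ := exists_invariant_sum_eq_zero_two_max
    (ComplexEmbedding.involutive_conjugate K) (by rwa [Embeddings.card K ℂ])
  exact exists_eventually_le_ncard_houseBounded_div (rank_pos_of_three_le hd) hα0 hα hconj hsum hv
    (δ := (1 - ν) / 8) (by linarith) (by linarith)
    (eventually_nearUnits_inter_generatingUnits_subset_twoLargeUnits hα0 hv h2 hν0 hν1)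

theorem exists_eventually_le_ncard_twoLargeTwoSmallUnits_div (hd : 4 ≤ finrank ℚ K) {α : K}
    (hα0 : α ≠ 0) (hα : ℚ⟮α⟯ = ⊤) {ν : ℝ} (hν0 : 0 < ν) (hν1 : ν < 1) :
    ∃ c : ℝ, 0 < c ∧ ∀ᶠ N : ℝ in atTop,
      c ≤ ((houseBounded α (twoLargeTwoSmallUnits α ν) N).ncard : ℝ) / Real.log N ^ rank K := by
  obtain ⟨v, hconj, hsum, hv, hv', h2, h2'⟩ := exists_invariant_sum_eq_zero_two_max_two_min
    (ComplexEmbedding.involutive_conjugate K) (by rwa [Embeddings.card K ℂ])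
  refine exists_eventually_le_ncard_houseBounded_div (rank_pos_of_three_le (by omega)) hα0 hα
    hconj hsum hv (δ := (1 - ν) / 8) (by linarith) (by linarith) ?_
  filter_upwards
    [eventually_nearUnits_inter_generatingUnits_subset_twoLargeUnits hα0 hv h2 hν0 hν1,
    eventually_nearUnits_inter_generatingUnits_subset_twoLargeUnits (inv_ne_zero hα0) (v := -v)
      hv' h2' hν0 hν1] with n h h' u hu
  exact ⟨h hu, h' ⟨inv_mem_nearUnits hu.1, inv_mem_generatingUnits hu.2⟩⟩

end Generating

/-! ### Lower limits and the final assembly. -/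

theorem pos_liminf_of_eventually_le {f : ℝ → ℝ} {c C : ℝ} (hc : 0 < c)
    (h : ∀ᶠ N in atTop, c ≤ f N) (h' : ∀ᶠ N in atTop, f N ≤ C) : 0 < liminf f atTop :=
  -- The upper bound is needed because a real `liminf` takes a junk value on a function tending to
  -- infinity.
  hc.trans_le (le_liminf_of_le (isBoundedUnder_of_eventually_le h').isCoboundedUnder_ge h)

theorem proposition2 {K : Type*} [Field K] [NumberField K] (α : K) (hα : ℚ⟮α⟯ = ⊤)
    (hd : 3 ≤ (minpoly ℚ α).natDegree) :
    -- (a)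
    ((∀ N : ℝ, (houseBounded α Set.univ N).Finite) ∧
      ∃ c : ℝ, 0 < c ∧
        Tendsto (fun N : ℝ =>
          ((houseBounded α Set.univ N).ncard : ℝ) / Real.log N ^ NumberField.Units.rank K)
          atTop (𝓝 c)) ∧
    -- (b)
    0 < liminf (fun N : ℝ =>
      ((houseBounded α (generatingUnits α) N).ncard : ℝ) /
        ((houseBounded α Set.univ N).ncard : ℝ)) atTop ∧
    -- (c)
    (∀ ν : ℝ, 0 < ν → ν < 1 / 2 →
      0 < liminf (fun N : ℝ =>
        ((houseBounded α (twoLargeUnits α ν) N).ncard : ℝ) /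
          Real.log N ^ NumberField.Units.rank K) atTop) ∧
    -- (d)
    (∀ ν : ℝ, 0 < ν → ν < 1 → 4 ≤ (minpoly ℚ α).natDegree →
      0 < liminf (fun N : ℝ =>
        ((houseBounded α (twoLargeTwoSmallUnits α ν) N).ncard : ℝ) /
          Real.log N ^ NumberField.Units.rank K) atTop) := by
  have hdeg : (minpoly ℚ α).natDegree = finrank ℚ K := by
    rw [← adjoin.finrank (Algebra.IsIntegral.isIntegral α), hα, finrank_top']
  have hα0 : α ≠ 0 := by
    rintro rfl
    rw [minpoly.zero, Polynomial.natDegree_X] at hd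
    omega
  rw [hdeg] at hd ⊢
  have hr := rank_pos_of_three_le hd
  obtain ⟨c, hc, hexp⟩ := exists_tendsto_ncard_houseBounded_exp hr hα0
  have hlim : Tendsto (fun N : ℝ =>
      ((houseBounded α Set.univ N).ncard : ℝ) / Real.log N ^ rank K) atTop (𝓝 c) := by
    refine (hexp.comp Real.tendsto_log_atTop).congr' ?_
    filter_upwards [eventually_gt_atTop 0] with N hN
    simp only [Function.comp_apply, Real.exp_log hN]
  have hmono (F G : Set (𝓞 K)ˣ) (h : F ⊆ G) (N : ℝ) :
      ((houseBounded α F N).ncard : ℝ) ≤ ((houseBounded α G N).ncard : ℝ) := by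
    have hsub : houseBounded α F N ⊆ houseBounded α G N := fun u hu => ⟨h hu.1, hu.2⟩
    exact_mod_cast Set.ncard_le_ncard hsub (finite_houseBounded hα0 G N)
  have hupper (F : Set (𝓞 K)ˣ) : ∀ᶠ N : ℝ in atTop,
      ((houseBounded α F N).ncard : ℝ) / Real.log N ^ rank K ≤ c + 1 := by
    filter_upwards [hlim.eventually_le_const (lt_add_one c), eventually_ge_atTop 1] with N hN hN1
    have := Real.log_nonneg hN1
    exact (div_le_div_of_nonneg_right (hmono F _ (Set.subset_univ F) N) (by positivity)).trans hN
  refine ⟨⟨finite_houseBounded hα0 _, c, hc, hlim⟩, ?_, fun ν h0 h1 => ?_, fun ν h0 h1 h4 => ?_⟩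
  -- Part (b) follows from the density of the smaller set `twoLargeUnits α ν`; any `ν` in `(0, 1)`
  -- would do.
  · obtain ⟨c', hc', h⟩ := exists_eventually_le_ncard_twoLargeUnits_div hd hα0 hα
      (ν := 1 / 4) (by norm_num) (by norm_num)
    refine pos_liminf_of_eventually_le (c := c' / (c + 1)) (C := 1) (by positivity) ?_
      (.of_forall fun N => div_le_one_of_le₀ (hmono _ _ (Set.subset_univ _) N) (by positivity))
    filter_upwards [h, hupper Set.univ, hlim.eventually_const_lt hc, eventually_gt_atTop 1]
      with N h1 h2 h3 hN
    have hl : 0 < Real.log N ^ rank K := pow_pos (Real.log_pos hN) _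
    have h4 := div_le_div_of_nonneg_right
      (hmono (twoLargeUnits α (1 / 4)) (generatingUnits α) (fun u hu => hu.1) N) hl.le
    exact (div_le_div₀ (hc'.le.trans (h1.trans h4)) (h1.trans h4) h3 h2).trans_eq
      (div_div_div_cancel_right₀ hl.ne' _ _)
  · obtain ⟨c', hc', h⟩ :=
      exists_eventually_le_ncard_twoLargeUnits_div hd hα0 hα h0 (by linarith)
    exact pos_liminf_of_eventually_le hc' h (hupper _)
  · obtain ⟨c', hc', h⟩ :=
      exists_eventually_le_ncard_twoLargeTwoSmallUnits_div h4 hα0 hα h0 h1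
    exact pos_liminf_of_eventually_le hc' h (hupper _)
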